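/- Conventions. All Hilbert spaces are finite-dimensional and $\log$ is the natural logarithm. For a positive semi-definite operator $A=\sum_i a_i|i\rangle\langle i|$ in eigendecomposition, functions are evaluated on the support, $f(A)=\sum_{i:a_i\neq 0}f(a_i)|i\rangle\langle i|$; in particular complex powers $A^z$ and $\log A$ are understood this way and $A^0$ is the projection onto $\operatorname{supp}(A)=\operatorname{span}\{|i\rangle:a_i\ne0\}$. For positive semi-definite $\rho,\tau$ put $$D(\rho\Vert\tau)=\operatorname{Tr}\{\rho[\log\rho-\log\tau]\},\qquad D_2(\rho\Vert\tau)=\log\operatorname{Tr}\{\rho^2\tau^{-1}\}$$ if $\operatorname{supp}(\rho)\subseteq\operatorname{supp}(\tau)$, both being $+\infty$ otherwise, and $D_0(\rho\Vert\tau)=-\log\operatorname{Tr}\{\rho^0\tau\}$ (with $-\log 0=+\infty$). For a quantum channel (linear, completely positive, trace-preserving map) $\mathcal N$ with Hilbert–Schmidt adjoint $\mathcal N^\dagger$ and a positive semi-definite $\sigma$, define the Petz recovery map $$\mathcal P_{\sigma,\mathcal N}(\cdot)=\sigma^{1/2}\,\mathcal N^\dagger\!\left([\mathcal N(\sigma)]^{-1/2}(\cdot)[\mathcal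 N(\sigma)]^{-1/2}\right)\sigma^{1/2},$$ and, for $t\in\mathbb R$, with $\mathcal U_{\omega,t}(\cdot)=\omega^{it}(\cdot)\,\omega^{-it}$, the rotated Petz recovery map $$\mathcal R^t_{\sigma,\mathcal N}=\mathcal U_{\sigma,t}\circ\mathcal P_{\sigma,\mathcal N}\circ\mathcal U_{\mathcal N(\sigma),-t}.$$ Theorem. (1) Let $\rho$ be a density operator and $\sigma$ a non-zero positive semi-definite operator on $\mathcal H$ with $\operatorname{supp}(\rho)\subseteq\operatorname{supp}(\sigma)$, and let $\mathcal N$ be a quantum channel from operators on $\mathcal H$ to operators on $\mathcal K$. Then $$\inf_{t\in\mathbb R}D_0\!\left(\rho\,\Vert\,\mathcal R^t_{\sigma,\mathcal N}(\mathcal N(\rho))\right)\le D(\rho\Vert\sigma)-D(\mathcal N(\rho)\Vert\mathcal N(\sigma)).$$ (2) Let $\rho$ be a positive definite density operator and $\sigma$ a positive definite operator on $\mathcal H_S\otimes\mathcal H_{E'}$, let $U:\mathcal H_S\otimes\mathcal H_{E'}\to\mathcal H_B\otimes\mathcal H_E$ be unitary, and let $\mathcal N(\theta)=\operatorname{Tr}_E\{U\theta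 U^\dagger\}$, with $\mathcal N(\rho)$ and $\mathcal N(\sigma)$ positive definite on $\mathcal H_B$. Then $$D(\rho\Vert\sigma)-D(\mathcal N(\rho)\Vert\mathcal N(\sigma))\le\sup_{t\in\mathbb R}D_2\!\left(\rho\,\Vert\,\mathcal R^t_{\sigma,\mathcal N}(\mathcal N(\rho))\right).$$ -/

import Mathlib

/-! Operators on a finite-dimensional Hilbert space are complex matrices with respect to a fixed
orthonormal basis, indexed by an arbitrary finite type. `log` is the natural logarithm. -/

open scoped ComplexOrder

noncomputable section

namespace QInfo

variable {n m : Type*} [Fintype n] [DecidableEq n] [Fintype m] [DecidableEq m]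

/-- A density operator: positive semi-definite with trace one. -/
def IsDensityOperator (ρ : Matrix n n ℂ) : Prop :=
  ρ.PosSemidef ∧ ρ.trace = 1

open scoped Matrix.Norms.L2Operator MatrixOrder CStarAlgebra in
/-- A quantum channel: a linear map which is completely positive and trace preserving. -/
def IsQuantumChannel (Φ : Matrix n n ℂ →ₗ[ℂ] Matrix m m ℂ) : Prop :=
  (∃ Ψ : Matrix n n ℂ →CP Matrix m m ℂ, Ψ.toLinearMap = Φ) ∧
    ∀ X : Matrix n n ℂ, (Φ X).trace = X.trace

/-- The support of a Hermitian operator: the span of its eigenvectors with non-zero eigenvalue. -/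
def supp (A : Matrix n n ℂ) : Submodule ℂ (n → ℂ) :=
  ⨆ (μ : ℂ) (_ : μ ≠ 0), Module.End.eigenspace (Matrix.toLin' A) μ

open Classical in
/-- A function of a Hermitian operator evaluated on its support:
`f(A) = ∑_{i : aᵢ ≠ 0} f(aᵢ) |i⟩⟨i|` for an eigendecomposition `A = ∑ᵢ aᵢ |i⟩⟨i|`.
(The value for a non-Hermitian `A` is irrelevant and set to `0`.) -/
def suppFun (f : ℝ → ℂ) (A : Matrix n n ℂ) : Matrix n n ℂ :=
  if hA : A.IsHermitian then
    (hA.eigenvectorUnitary : Matrix n n ℂ) *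
      Matrix.diagonal (fun i => if hA.eigenvalues i = 0 then 0 else f (hA.eigenvalues i)) *
      (hA.eigenvectorUnitary : Matrix n n ℂ).conjTranspose
  else 0

/-- The complex power `A ^ z` of a positive semi-definite operator, taken on its support;
in particular `A ^ 0` is the projection onto the support of `A`. -/
def suppPow (A : Matrix n n ℂ) (z : ℂ) : Matrix n n ℂ :=
  suppFun (fun x => (x : ℂ) ^ z) A

/-- The logarithm of a positive semi-definite operator, taken on its support. -/
def suppLog (A : Matrix n n ℂ) : Matrix n n ℂ :=
  suppFun (fun x => (Real.log x : ℂ)) A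

open Classical in
/-- The quantum relative entropy `D(ρ‖σ) = Tr{ρ [log ρ - log σ]}` if `supp ρ ⊆ supp σ`,
and `+∞` otherwise. -/
def relEntropy (ρ σ : Matrix n n ℂ) : EReal :=
  if supp ρ ≤ supp σ then (((ρ * (suppLog ρ - suppLog σ)).trace.re : ℝ) : EReal) else ⊤

/-- The zero-relative entropy `D₀(ρ‖τ) = -log Tr{ρ⁰ τ}`, with `-log 0 = +∞`. -/
def zeroRelEntropy (ρ τ : Matrix n n ℂ) : EReal :=
  -ENNReal.log (ENNReal.ofReal (suppPow ρ 0 * τ).trace.re)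

open Classical in
/-- The collision relative entropy, i.e. the Rényi relative entropy of order two:
`D₂(ρ‖τ) = log Tr{ρ² τ⁻¹}` if `supp ρ ⊆ supp τ`, and `+∞` otherwise. -/
def collisionRelEntropy (ρ τ : Matrix n n ℂ) : EReal :=
  if supp ρ ≤ supp τ then
    ENNReal.log (ENNReal.ofReal (suppPow ρ 2 * suppPow τ (-1)).trace.re)
  else ⊤

/-- The adjoint of a linear map with respect to the Hilbert–Schmidt inner products
`⟨X, Y⟩ = Tr{Xᴴ Y}`, through its matrix entries `⟨E_{ij}, Φ†(Y)⟩ = ⟨Φ(E_{ij}), Y⟩`. -/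
def hsAdjoint (Φ : Matrix n n ℂ →ₗ[ℂ] Matrix m m ℂ) (Y : Matrix m m ℂ) : Matrix n n ℂ :=
  Matrix.of fun i j => ((Φ (Matrix.single i j 1)).conjTranspose * Y).trace

/-- The defining property of the Hilbert–Schmidt adjoint. -/
theorem trace_conjTranspose_mul_hsAdjoint {n m : Type*} [Fintype n] [DecidableEq n]
    [Fintype m] (Φ : Matrix n n ℂ →ₗ[ℂ] Matrix m m ℂ)
    (X : Matrix n n ℂ) (Y : Matrix m m ℂ) :
    (X.conjTranspose * hsAdjoint Φ Y).trace = ((Φ X).conjTranspose * Y).trace := by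
  conv_rhs => rw [Matrix.matrix_eq_sum_single X]
  have h : ∀ i j, Φ (Matrix.single i j (X i j)) = X i j • Φ (Matrix.single i j 1) := by
    intro i j
    rw [← map_smul, Matrix.smul_single, smul_eq_mul, mul_one]
  simp only [map_sum, h, Matrix.conjTranspose_sum, Matrix.conjTranspose_smul, Finset.sum_mul,
    Matrix.smul_mul, Matrix.trace_sum, Matrix.trace_smul]
  simp only [Matrix.trace, Matrix.diag, Matrix.mul_apply, Matrix.conjTranspose_apply, hsAdjoint,
    Matrix.of_apply, smul_eq_mul]
  rw [Finset.sum_comm]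

/-- The Petz recovery map
`P(Y) = σ^{1/2} Φ†(Φ(σ)^{-1/2} Y Φ(σ)^{-1/2}) σ^{1/2}`. -/
def petzMap (σ : Matrix n n ℂ) (Φ : Matrix n n ℂ →ₗ[ℂ] Matrix m m ℂ) (Y : Matrix m m ℂ) :
    Matrix n n ℂ :=
  suppPow σ (1 / 2) *
    hsAdjoint Φ (suppPow (Φ σ) (-(1 / 2)) * Y * suppPow (Φ σ) (-(1 / 2))) *
    suppPow σ (1 / 2)

/-- The partial isometric map `X ↦ ω^{it} X ω^{-it}`. -/
def rotation (ω : Matrix n n ℂ) (t : ℝ) (X : Matrix n n ℂ) : Matrix n n ℂ :=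
  suppPow ω (Complex.I * (t : ℂ)) * X * suppPow ω (-(Complex.I * (t : ℂ)))

/-- The rotated Petz recovery map. -/
def rotatedPetzMap (σ : Matrix n n ℂ) (Φ : Matrix n n ℂ →ₗ[ℂ] Matrix m m ℂ) (t : ℝ)
    (Y : Matrix m m ℂ) : Matrix n n ℂ :=
  rotation σ t (petzMap σ Φ (rotation (Φ σ) (-t) Y))

/-- The partial trace over the second tensor factor. -/
def partialTrace (b e : Type*) [Fintype e] : Matrix (b × e) (b × e) ℂ →ₗ[ℂ] Matrix b b ℂ where
  toFun X := Matrix.of fun i j => ∑ k, X (i, k) (j, k)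
  map_add' X Y := by
    ext i j
    simp [Finset.sum_add_distrib]
  map_smul' c X := by
    ext i j
    simp [Finset.mul_sum]

/-- The map `θ ↦ Tr_E {U θ Uᴴ}` for an operator `U` from a space with basis `n`
to the tensor product of spaces with bases `b` and `e`. -/
def dilationMap {b e : Type*} [Fintype b] [Fintype e] (U : Matrix (b × e) n ℂ) :
    Matrix n n ℂ →ₗ[ℂ] Matrix b b ℂ where
  toFun θ := partialTrace b e (U * θ * U.conjTranspose)
  map_add' X Y := by rw [Matrix.mul_add, Matrix.add_mul, map_add]
  map_smul' c X := by
    rw [Matrix.mul_smul, Matrix.smul_mul, map_smul, RingHom.id_apply]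

end QInfo

end

/-! Both inequalities come from one holomorphic function. By Stinespring, write `N(θ) = Tr_E {U θ
Uᴴ}` with `U` an isometry (`IsQuantumChannel.exists_dilation`), and put `G(z) = (N(ρ)^{z/2}
N(σ)^{-z/2} ⊗ 1) U σ^{z/2} ρ^{(1-z)/2}` and `g(z) = Tr {G(0)ᴴ G(z)}`. Since `G(0) = U ρ^{1/2}` has
Frobenius norm one, `g(0) = 1`, and Cauchy–Schwarz bounds `|g(z)|` by the norm of `G(z)`.
Differentiation gives `g'(0) = -Δ/2`, where `Δ` is the difference of relative entropies
(`hasDerivAt_petzOverlap_zero`). On `Re z = 0` every power acts as a partial isometry applied to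
`ρ^{1/2}`, so `|g| ≤ 1`. On `Re z = 1` the squared norm of `G` is `Tr {ρ⁰ R^s(N(ρ))}`
(`frobSq_petzCurve_one_add`), and on `Re z = -1`, in the invertible unitary case, it is `Tr {ρ²
R^s(N(ρ))⁻¹}` (`frobSq_petzCurve_neg_one_add`); here `s = -t/2` for `t = Im z`. If the first trace
is at most `exp (-r)` for all `s`, the three lines theorem yields `Re g(x) ≤ exp (-r x / 2)` on `[0,
1]`, with equality at `0`; comparing slopes there (`re_deriv_le_of_three_lines`) gives `r ≤ Δ`,
which is (1). The same argument for `g(-z)` gives (2). -/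

noncomputable section

namespace QInfo

open Matrix
open scoped Kronecker

/-! ### Functional calculus on the support. -/

section FunctionalCalculus

variable {n : Type*} [Fintype n] [DecidableEq n]

theorem suppFun_of_isHermitian {A : Matrix n n ℂ} (hA : A.IsHermitian) (f : ℝ → ℂ) :
    suppFun f A = (hA.eigenvectorUnitary : Matrix n n ℂ) *
      diagonal (fun i => if hA.eigenvalues i = 0 then 0 else f (hA.eigenvalues i)) *
      (hA.eigenvectorUnitary : Matrix n n ℂ)ᴴ := by
  rw [suppFun, dif_pos hA]

theorem suppFun_mul_suppFun (f g : ℝ → ℂ) (A : Matrix n n ℂ) :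
    suppFun f A * suppFun g A = suppFun (fun x => f x * g x) A := by
  by_cases hA : A.IsHermitian
  · have hV : (hA.eigenvectorUnitary : Matrix n n ℂ)ᴴ * (hA.eigenvectorUnitary : Matrix n n ℂ) = 1 :=
      Unitary.coe_star_mul_self _
    simp only [suppFun_of_isHermitian hA, Matrix.mul_assoc]
    rw [← Matrix.mul_assoc _ᴴ, hV, Matrix.one_mul, ← Matrix.mul_assoc (diagonal _),
      diagonal_mul_diagonal]
    congr 3
    ext i
    split_ifs <;> simp
  · simp [suppFun, hA]

theorem conjTranspose_suppFun (f : ℝ → ℂ) (A : Matrix n n ℂ) :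
    (suppFun f A)ᴴ = suppFun (fun x => star (f x)) A := by
  by_cases hA : A.IsHermitian
  · simp only [suppFun_of_isHermitian hA, conjTranspose_mul, conjTranspose_conjTranspose,
      diagonal_conjTranspose, Matrix.mul_assoc]
    congr 3
    ext i
    simp only [Pi.star_apply]
    split_ifs <;> simp
  · simp [suppFun, hA]

theorem suppFun_congr {A : Matrix n n ℂ} (hA : A.PosSemidef) {f g : ℝ → ℂ}
    (h : ∀ x, 0 < x → f x = g x) : suppFun f A = suppFun g A := by
  rw [suppFun_of_isHermitian hA.1, suppFun_of_isHermitian hA.1]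
  congr 3
  ext i
  split_ifs with h0
  · rfl
  · exact h _ (lt_of_le_of_ne (hA.eigenvalues_nonneg i) (Ne.symm h0))

theorem suppPow_one {A : Matrix n n ℂ} (hA : A.IsHermitian) : suppPow A 1 = A := by
  conv_rhs => rw [hA.spectral_theorem]
  rw [suppPow, suppFun_of_isHermitian hA, Unitary.conjStarAlgAut_apply]
  congr 3
  ext i
  simp only [Complex.cpow_one, Function.comp_apply]
  split_ifs with h <;> simp [h]

theorem suppPow_mul_suppPow {A : Matrix n n ℂ} (hA : A.PosSemidef) (z w : ℂ) :
    suppPow A z * suppPow A w = suppPow A (z + w) := by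
  rw [suppPow, suppPow, suppFun_mul_suppFun]
  exact suppFun_congr hA fun x hx => (Complex.cpow_add _ _ (by exact_mod_cast hx.ne')).symm

theorem suppPow_mul_suppPow_assoc {m : Type*} {A : Matrix n n ℂ}
    (hA : A.PosSemidef) (z w : ℂ) (X : Matrix n m ℂ) :
    suppPow A z * (suppPow A w * X) = suppPow A (z + w) * X := by
  rw [← Matrix.mul_assoc, suppPow_mul_suppPow hA]

theorem conjTranspose_suppPow {A : Matrix n n ℂ} (hA : A.PosSemidef) (z : ℂ) :
    (suppPow A z)ᴴ = suppPow A (star z) := by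
  rw [suppPow, conjTranspose_suppFun]
  refine suppFun_congr hA fun x hx => ?_
  have := Complex.cpow_conj (x : ℂ) z (by rw [Complex.arg_ofReal_of_nonneg hx.le]; exact Real.pi_pos.ne)
  simpa using this.symm

/-- Only non-zero eigenvalues enter, so positivity is not needed; this lets `suppPow_neg_one_eq`
treat the recovered operator as merely Hermitian. -/
theorem suppPow_mul_self {A : Matrix n n ℂ} (hA : A.IsHermitian) (z : ℂ) :
    suppPow A z * A = suppPow A (z + 1) := by
  have h : suppPow A z * suppPow A 1 = suppPow A (z + 1) := by
    rw [suppPow, suppPow, suppFun_mul_suppFun, suppPow, suppFun_of_isHermitian hA,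
      suppFun_of_isHermitian hA]
    congr 3
    ext i
    split_ifs with h
    · rfl
    · rw [Complex.cpow_add _ _ (by exact_mod_cast h)]
  rwa [suppPow_one hA] at h

theorem self_mul_suppPow {A : Matrix n n ℂ} (hA : A.IsHermitian) (z : ℂ) :
    A * suppPow A z = suppPow A (z + 1) := by
  have h : suppPow A 1 * suppPow A z = suppPow A z * suppPow A 1 := by
    simp only [suppPow, suppFun_mul_suppFun, mul_comm]
  rwa [suppPow_one hA, suppPow_mul_self hA] at h

theorem suppPow_zero_mul_self {A : Matrix n n ℂ} (hA : A.IsHermitian) : suppPow A 0 * A = A := by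
  rw [suppPow_mul_self hA, zero_add, suppPow_one hA]

/-- The support of a Hermitian operator is its range. -/
theorem mem_supp_iff {A : Matrix n n ℂ} (hA : A.IsHermitian) (x : n → ℂ) :
    x ∈ supp A ↔ ∃ y, A *ᵥ y = x := by
  constructor
  · intro hx
    have h : supp A ≤ LinearMap.range (toLin' A) := by
      refine iSup₂_le fun μ hμ y hy => ?_
      rw [Module.End.mem_eigenspace_iff] at hy
      exact ⟨μ⁻¹ • y, by rw [map_smul, hy, smul_smul, inv_mul_cancel₀ hμ, one_smul]⟩
    obtain ⟨y, hy⟩ := h hx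
    exact ⟨y, by simpa using hy⟩
  · rintro ⟨y, rfl⟩
    have hy : WithLp.toLp 2 y = ∑ i, hA.eigenvectorBasis.repr (WithLp.toLp 2 y) i •
        hA.eigenvectorBasis i := (hA.eigenvectorBasis.sum_repr _).symm
    have hy' : y = ∑ i, hA.eigenvectorBasis.repr (WithLp.toLp 2 y) i •
        (hA.eigenvectorBasis i).ofLp := by
      have := congrArg WithLp.ofLp hy
      simpa using this
    rw [hy', mulVec_sum]
    refine Submodule.sum_mem _ fun i _ => ?_
    rw [mulVec_smul, hA.mulVec_eigenvectorBasis]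
    refine Submodule.smul_mem _ _ ?_
    by_cases h0 : hA.eigenvalues i = 0
    · simp [h0]
    · refine (Submodule.mem_iSup_of_mem (hA.eigenvalues i : ℂ)
        (Submodule.mem_iSup_of_mem (by exact_mod_cast h0) ?_))
      rw [Module.End.mem_eigenspace_iff, toLin'_apply, mulVec_smul, hA.mulVec_eigenvectorBasis,
        smul_comm]
      rfl

/-- Supports are ranges: `B⁰` fixes the range of `B`, and conversely `B⁰ = B B⁻¹` maps into it. The
algebraic form is the one used in all later computations. -/
theorem supp_le_supp_iff {A B : Matrix n n ℂ} (hA : A.IsHermitian) (hB : B.PosSemidef) :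
    supp A ≤ supp B ↔ suppPow B 0 * A = A := by
  constructor
  · intro h
    refine ext_of_mulVec_single fun j => ?_
    obtain ⟨y, hy⟩ := (mem_supp_iff hB.1 _).1 (h ((mem_supp_iff hA _).2 ⟨Pi.single j 1, rfl⟩))
    rw [← mulVec_mulVec, ← hy, mulVec_mulVec, suppPow_zero_mul_self hB.1]
  · intro h x hx
    obtain ⟨y, rfl⟩ := (mem_supp_iff hA _).1 hx
    refine (mem_supp_iff hB.1 _).2 ⟨(suppPow B (-1) * A) *ᵥ y, ?_⟩
    rw [mulVec_mulVec]
    nth_rewrite 1 [← suppPow_one hB.1]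
    rw [suppPow_mul_suppPow_assoc hB, add_neg_cancel, h]

theorem suppPow_zero_eq_one {A : Matrix n n ℂ} (hA : A.PosDef) : suppPow A 0 = 1 := by
  have h := suppPow_zero_mul_self hA.1
  exact hA.isUnit.mul_right_cancel (by rw [h, one_mul])

/-- A left inverse forces `A⁰ = 1`, after which the inverse on the support is the ordinary one. -/
theorem suppPow_neg_one_eq {A B : Matrix n n ℂ} (hA : A.IsHermitian) (h : B * A = 1) :
    suppPow A (-1) = B := by
  have h0 : suppPow A 0 = 1 := by
    have h1 : A * suppPow A 0 = A := by rw [self_mul_suppPow hA, zero_add, suppPow_one hA]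
    calc suppPow A 0 = B * (A * suppPow A 0) := by rw [← Matrix.mul_assoc, h, Matrix.one_mul]
      _ = 1 := by rw [h1, h]
  calc suppPow A (-1) = B * (A * suppPow A (-1)) := by
        rw [← Matrix.mul_assoc, h, Matrix.one_mul]
    _ = B := by rw [self_mul_suppPow hA, neg_add_cancel, h0, Matrix.mul_one]

end FunctionalCalculus

/-! ### Partial trace, ampliation and the adjoint of a dilation. -/

section Ampliation

theorem posSemidef_dilationMap {n b e : Type*} [Fintype n] [Fintype b] [Fintype e]
    (U : Matrix (b × e) n ℂ) {X : Matrix n n ℂ} (hX : X.PosSemidef) :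
    (dilationMap U X).PosSemidef := by
  have h := hX.mul_mul_conjTranspose_same U
  have h1 : dilationMap U X = ∑ k : e, (U * X * Uᴴ).submatrix (fun i => (i, k)) (fun i => (i, k)) := by
    ext i j
    simp [dilationMap, partialTrace, Matrix.sum_apply]
  rw [h1]
  exact posSemidef_sum _ fun k _ => h.submatrix _

variable {n b e : Type*}

/-- The ampliation `X ⊗ 1` of an operator. -/
def ampliation (e : Type*) [DecidableEq e] (X : Matrix b b ℂ) : Matrix (b × e) (b × e) ℂ :=
  X ⊗ₖ (1 : Matrix e e ℂ)

variable [DecidableEq e]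

theorem ampliation_apply (X : Matrix b b ℂ) (i j : b × e) :
    ampliation e X i j = X i.1 j.1 * (1 : Matrix e e ℂ) i.2 j.2 := rfl

theorem conjTranspose_ampliation (X : Matrix b b ℂ) :
    (ampliation e X)ᴴ = ampliation e Xᴴ := by
  rw [ampliation, ampliation, conjTranspose_kronecker, conjTranspose_one]

theorem ampliation_one [DecidableEq b] : ampliation e (1 : Matrix b b ℂ) = 1 :=
  one_kronecker_one

theorem ampliation_sub (X Y : Matrix b b ℂ) :
    ampliation e (X - Y) = ampliation e X - ampliation e Y := by
  ext i j
  simp [ampliation_apply, sub_mul]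

theorem ampliation_add (X Y : Matrix b b ℂ) :
    ampliation e (X + Y) = ampliation e X + ampliation e Y := by
  ext i j
  simp [ampliation_apply, add_mul]

theorem ampliation_smul (c : ℂ) (X : Matrix b b ℂ) :
    ampliation e (c • X) = c • ampliation e X := by
  ext i j
  simp [ampliation_apply, mul_assoc]

variable [Fintype b] [Fintype e]

theorem ampliation_mul (X Y : Matrix b b ℂ) :
    ampliation e (X * Y) = ampliation e X * ampliation e Y := by
  rw [ampliation, ampliation, ampliation, ← mul_kronecker_mul, Matrix.one_mul]

theorem ampliation_mul_mul {m : Type*} (X Y : Matrix b b ℂ) (Z : Matrix (b × e) m ℂ) :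
    ampliation e X * (ampliation e Y * Z) = ampliation e (X * Y) * Z := by
  rw [ampliation_mul, Matrix.mul_assoc]

theorem trace_ampliation_mul (X : Matrix b b ℂ) (M : Matrix (b × e) (b × e) ℂ) :
    (ampliation e X * M).trace = (X * partialTrace b e M).trace := by
  simp only [Matrix.trace, Matrix.diag, Matrix.mul_apply, ampliation_apply, partialTrace,
    Fintype.sum_prod_type, LinearMap.coe_mk, AddHom.coe_mk, Matrix.of_apply, one_apply, mul_ite,
    mul_one, mul_zero, ite_mul, zero_mul, Finset.sum_ite_eq, Finset.mem_univ, if_true,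
    Finset.mul_sum]
  exact Finset.sum_congr rfl fun i _ => Finset.sum_comm

variable [Fintype n]

theorem hsAdjoint_dilationMap [DecidableEq n] (U : Matrix (b × e) n ℂ) (Y : Matrix b b ℂ) :
    hsAdjoint (dilationMap U) Y = Uᴴ * ampliation e Y * U := by
  ext i j
  have h : ((dilationMap U (single i j 1))ᴴ * Y).trace = (Uᴴ * ampliation e Y * U) i j := by
    have h1 : (dilationMap U (single i j 1))ᴴ = partialTrace b e (U * single j i (1 : ℂ) * Uᴴ) := by
      have h2 : ∀ M : Matrix (b × e) (b × e) ℂ, (partialTrace b e M)ᴴ = partialTrace b e Mᴴ := by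
        intro M
        ext
        simp [partialTrace]
      simp only [dilationMap, LinearMap.coe_mk, AddHom.coe_mk, h2, conjTranspose_mul,
        conjTranspose_conjTranspose, conjTranspose_single, star_one, Matrix.mul_assoc]
    rw [h1, Matrix.trace_mul_comm, ← trace_ampliation_mul, Matrix.mul_assoc U,
      ← Matrix.mul_assoc, Matrix.trace_mul_comm, Matrix.mul_assoc, Matrix.trace_single_mul]
    simp [Matrix.mul_assoc]
  simpa [hsAdjoint] using h

theorem trace_mul_dilationMap (U : Matrix (b × e) n ℂ) (X : Matrix n n ℂ) (Y : Matrix b b ℂ) :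
    (Y * dilationMap U X).trace = (ampliation e Y * (U * X * Uᴴ)).trace :=
  (trace_ampliation_mul Y _).symm

theorem dilationMap_eq_of_ampliation_mul (U : Matrix (b × e) n ℂ) (X : Matrix n n ℂ)
    (Q : Matrix b b ℂ) (h : ampliation e Q * (U * X) = U * X) :
    Q * dilationMap U X = dilationMap U X := by
  have h1 : Q * dilationMap U X = partialTrace b e (ampliation e Q * (U * X * Uᴴ)) := by
    ext i j
    simp only [dilationMap, partialTrace, LinearMap.coe_mk, AddHom.coe_mk, Matrix.of_apply,
      Matrix.mul_apply (M := Q), Matrix.mul_apply (M := ampliation e Q), ampliation_apply,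
      Fintype.sum_prod_type, one_apply, mul_ite, mul_one, mul_zero, ite_mul, zero_mul,
      Finset.sum_ite_eq, Finset.mem_univ, if_true, Finset.mul_sum]
    exact Finset.sum_comm
  rw [h1, ← Matrix.mul_assoc, h]
  rfl

variable [DecidableEq b] [DecidableEq n]

/-- The support of `U ρ Uᴴ` is contained in `supp (Tr_E U ρ Uᴴ) ⊗ E`. -/
theorem ampliation_suppPow_zero_mul (U : Matrix (b × e) n ℂ) {ρ : Matrix n n ℂ}
    (hρ : ρ.PosSemidef) :
    ampliation e (suppPow (dilationMap U ρ) 0) * (U * suppPow ρ (1 / 2)) =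
      U * suppPow ρ (1 / 2) := by
  have hA := posSemidef_dilationMap U hρ
  set A := dilationMap U ρ with hAdef
  set X := U * suppPow ρ (1 / 2) with hX
  have hXX : X * Xᴴ = U * ρ * Uᴴ := by
    rw [hX, conjTranspose_mul, conjTranspose_suppPow hρ, Matrix.mul_assoc,
      suppPow_mul_suppPow_assoc hρ, ← Matrix.mul_assoc]
    have : (1 / 2 + star (1 / 2) : ℂ) = 1 := by norm_num
    rw [this, suppPow_one hρ.1]
  have hP : (1 - suppPow A 0)ᴴ * (1 - suppPow A 0) = 1 - suppPow A 0 := by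
    rw [conjTranspose_sub, conjTranspose_one, conjTranspose_suppPow hA, star_zero, Matrix.sub_mul,
      Matrix.mul_sub, Matrix.mul_sub, suppPow_mul_suppPow hA]
    simp
  -- The squared Frobenius norm of `((1 - A⁰) ⊗ 1) X` equals `Tr {(1 - A⁰) A} = 0`.
  have h0 : ((ampliation e (1 - suppPow A 0) * X)ᴴ * (ampliation e (1 - suppPow A 0) * X)).trace
      = 0 := by
    rw [conjTranspose_mul, conjTranspose_ampliation, Matrix.mul_assoc, ampliation_mul_mul, hP,
      Matrix.trace_mul_comm, Matrix.mul_assoc, hXX, ← trace_mul_dilationMap, ← hAdef,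
      Matrix.sub_mul, suppPow_zero_mul_self hA.1, Matrix.one_mul, sub_self, trace_zero]
  rw [trace_conjTranspose_mul_self_eq_zero_iff, ampliation_sub, ampliation_one, Matrix.sub_mul,
    Matrix.one_mul, sub_eq_zero] at h0
  exact h0.symm

end Ampliation

/-! ### Stinespring dilation of a quantum channel. -/

section Stinespring

variable {n m : Type*} [Fintype n] [DecidableEq n] [Fintype m] [DecidableEq m]

theorem exists_eq_star_mul_self_of_nonneg {A : Type*} [NonUnitalCStarAlgebra A] [PartialOrder A]
    [StarOrderedRing A] {a : A} (ha : 0 ≤ a) : ∃ b, a = star b * b :=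
  CStarAlgebra.nonneg_iff_eq_star_mul_self.1 ha

open scoped Matrix.Norms.L2Operator MatrixOrder CStarAlgebra in
-- Choi's argument: the block matrix `(E_{ij})` is positive, so its blockwise image is positive and
-- factors as `star B * B`.
theorem exists_sum_of_completelyPositive [Nonempty n] (Ψ : Matrix n n ℂ →CP Matrix m m ℂ) :
    ∃ B : n → n → Matrix m m ℂ, ∀ i j, Ψ (single i j 1) = ∑ k, (B k i)ᴴ * B k j := by
  obtain ⟨k₀⟩ := ‹Nonempty n›
  -- Only block row `k₀` is non-zero, so `star C * C` has blocks `E_{i k₀} E_{k₀ j} = E_{ij}`.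
  let C : CStarMatrix n n (Matrix n n ℂ) :=
    CStarMatrix.ofMatrix (Matrix.of fun k j => if k = k₀ then single k j 1 else 0)
  have h := CompletelyPositiveMap.map_cstarMatrix_nonneg Ψ (star C * C) (star_mul_self_nonneg C)
  obtain ⟨B, hB⟩ := exists_eq_star_mul_self_of_nonneg h
  refine ⟨fun i j => B i j, fun i j => ?_⟩
  have h1 := congrArg (fun M : CStarMatrix n n (Matrix m m ℂ) => M i j) hB
  have h2 : (star C * C) i j = single i j (1 : ℂ) := by
    rw [CStarMatrix.mul_apply]
    simp [C, CStarMatrix.star_apply, star_eq_conjTranspose]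
  simp only [CStarMatrix.map_apply, h2] at h1
  rw [h1, CStarMatrix.mul_apply]
  simp [CStarMatrix.star_apply, star_eq_conjTranspose]

/-- The Stinespring dilation of a quantum channel. -/
theorem IsQuantumChannel.exists_dilation [Nonempty n] {Φ : Matrix n n ℂ →ₗ[ℂ] Matrix m m ℂ}
    (hΦ : IsQuantumChannel Φ) :
    ∃ U : Matrix (m × (n × m)) n ℂ, Φ = dilationMap U ∧ Uᴴ * U = 1 := by
  obtain ⟨⟨Ψ, hΨ⟩, htr⟩ := hΦ
  obtain ⟨B, hB⟩ := exists_sum_of_completelyPositive Ψ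
  -- The environment `n × m` carries the block index `k` and the summation index of the product `(B
  -- k i)ᴴ * B k j`.
  let U : Matrix (m × (n × m)) n ℂ := Matrix.of fun p i => star (B p.2.1 i p.2.2 p.1)
  have hU : ∀ i j, dilationMap U (single i j 1) = Φ (single i j 1) := by
    intro i j
    have h1 : Φ (single i j 1) = ∑ k, (B k i)ᴴ * B k j := by rw [← hΨ]; exact hB i j
    rw [h1]
    ext x y
    simp [dilationMap, partialTrace, Matrix.sum_apply, Matrix.mul_apply, U, Fintype.sum_prod_type,
      single_apply, ite_and]
  have hΦU : Φ = dilationMap U := by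
    refine LinearMap.ext fun X => ?_
    rw [matrix_eq_sum_single X]
    have h : ∀ i j, (single i j (X i j) : Matrix n n ℂ) = X i j • single i j 1 := by
      intro i j
      rw [smul_single, smul_eq_mul, mul_one]
    simp only [h, map_sum, map_smul, hU]
  refine ⟨U, hΦU, ?_⟩
  ext i j
  -- Trace preservation on `E_{ji}` reads off the entry `(Uᴴ U)_{ij} = Tr E_{ji}`.
  have h1 := htr (single j i 1)
  rw [hΦU] at h1
  have h2 := trace_mul_dilationMap U (single j i 1) 1
  rw [Matrix.one_mul, h1, ampliation_one, Matrix.one_mul, Matrix.mul_assoc, Matrix.trace_mul_comm,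
    Matrix.mul_assoc, Matrix.trace_single_mul] at h2
  rw [one_smul] at h2
  rw [← h2]
  by_cases hij : i = j
  · subst hij
    simp
  · rw [one_apply_ne hij, trace_single_eq_of_ne _ _ _ (Ne.symm hij)]

end Stinespring

/-! ### Entrywise holomorphy and boundedness of operator powers. -/

section Calculus

variable {k l p q : Type*}

/-- Entrywise differentiability of a matrix-valued function of a complex variable. -/
def HasEntryDerivAt (F : ℂ → Matrix p q ℂ) (F' : Matrix p q ℂ) (z : ℂ) : Prop :=
  ∀ i j, HasDerivAt (fun w => F w i j) (F' i j) z

/-- Boundedness of all the matrix entries on the strip `|Re z| ≤ 1`. -/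
def BoundedOnStrip (F : ℂ → Matrix p q ℂ) : Prop :=
  ∀ i j, ∃ C : ℝ, ∀ z : ℂ, |z.re| ≤ 1 → ‖F z i j‖ ≤ C

theorem hasEntryDerivAt_const (M : Matrix p q ℂ) (z : ℂ) : HasEntryDerivAt (fun _ => M) 0 z :=
  fun _ _ => hasDerivAt_const _ _

theorem boundedOnStrip_const (M : Matrix p q ℂ) : BoundedOnStrip fun _ => M :=
  fun i j => ⟨‖M i j‖, fun _ _ => le_rfl⟩

theorem HasEntryDerivAt.mul [Fintype q] {F : ℂ → Matrix p q ℂ} {G : ℂ → Matrix q l ℂ}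
    {F' : Matrix p q ℂ} {G' : Matrix q l ℂ} {z : ℂ} (hF : HasEntryDerivAt F F' z)
    (hG : HasEntryDerivAt G G' z) :
    HasEntryDerivAt (fun w => F w * G w) (F' * G z + F z * G') z := by
  intro i j
  simp only [Matrix.mul_apply, Matrix.add_apply, ← Finset.sum_add_distrib]
  exact HasDerivAt.fun_sum fun x _ => (hF i x).mul (hG x j)

theorem BoundedOnStrip.mul [Fintype q] {F : ℂ → Matrix p q ℂ} {G : ℂ → Matrix q l ℂ}
    (hF : BoundedOnStrip F) (hG : BoundedOnStrip G) : BoundedOnStrip fun w => F w * G w := by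
  intro i j
  choose C hC using hF
  choose D hD using hG
  refine ⟨∑ x, C i x * D x j, fun z hz => ?_⟩
  beta_reduce
  rw [Matrix.mul_apply]
  refine (norm_sum_le _ _).trans (Finset.sum_le_sum fun x _ => ?_)
  rw [norm_mul]
  exact mul_le_mul (hC i x z hz) (hD x j z hz) (norm_nonneg _)
    ((norm_nonneg _).trans (hC i x z hz))

theorem HasEntryDerivAt.ampliation [DecidableEq q] {F : ℂ → Matrix p p ℂ} {F' : Matrix p p ℂ}
    {z : ℂ} (hF : HasEntryDerivAt F F' z) :
    HasEntryDerivAt (fun w => ampliation q (F w)) (ampliation q F') z :=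
  fun i j => (hF i.1 j.1).mul_const _

theorem BoundedOnStrip.ampliation [DecidableEq q] {F : ℂ → Matrix p p ℂ}
    (hF : BoundedOnStrip F) : BoundedOnStrip fun w => ampliation q (F w) := by
  intro i j
  obtain ⟨C, hC⟩ := hF i.1 j.1
  refine ⟨C * ‖(1 : Matrix q q ℂ) i.2 j.2‖, fun z hz => ?_⟩
  beta_reduce
  rw [ampliation_apply, norm_mul]
  exact mul_le_mul_of_nonneg_right (hC z hz) (norm_nonneg _)

theorem HasEntryDerivAt.trace [Fintype p] {F : ℂ → Matrix p p ℂ} {F' : Matrix p p ℂ}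
    {z : ℂ} (hF : HasEntryDerivAt F F' z) :
    HasDerivAt (fun w => (F w).trace) F'.trace z :=
  HasDerivAt.fun_sum fun i _ => hF i i

theorem BoundedOnStrip.trace [Fintype p] {F : ℂ → Matrix p p ℂ} (hF : BoundedOnStrip F) :
    ∃ C : ℝ, ∀ z : ℂ, |z.re| ≤ 1 → ‖(F z).trace‖ ≤ C := by
  choose C hC using hF
  exact ⟨∑ i, C i i, fun z hz =>
    (norm_sum_le _ _).trans (Finset.sum_le_sum fun i _ => hC i i z hz)⟩

variable [Fintype p] [DecidableEq p]

theorem suppPow_apply {A : Matrix p p ℂ} (hA : A.IsHermitian) (z : ℂ) (i j : p) :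
    suppPow A z i j = ∑ x, (hA.eigenvectorUnitary : Matrix p p ℂ) i x *
      (if hA.eigenvalues x = 0 then 0 else (hA.eigenvalues x : ℂ) ^ z) *
      star ((hA.eigenvectorUnitary : Matrix p p ℂ) j x) := by
  rw [suppPow, suppFun_of_isHermitian hA, Matrix.mul_apply]
  simp [Matrix.mul_diagonal]

theorem hasEntryDerivAt_suppPow {A : Matrix p p ℂ} (hA : A.PosSemidef) (a b z : ℂ) :
    HasEntryDerivAt (fun w => suppPow A (a * w + b)) (a • (suppLog A * suppPow A (a * z + b))) z := by
  intro i j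
  have h : (suppLog A * suppPow A (a * z + b)) i j =
      ∑ x, (hA.1.eigenvectorUnitary : Matrix p p ℂ) i x *
      (if hA.1.eigenvalues x = 0 then 0 else
        (Real.log (hA.1.eigenvalues x) : ℂ) * (hA.1.eigenvalues x : ℂ) ^ (a * z + b)) *
      star ((hA.1.eigenvectorUnitary : Matrix p p ℂ) j x) := by
    rw [suppLog, suppPow, suppFun_mul_suppFun, suppFun_of_isHermitian hA.1, Matrix.mul_apply]
    simp [Matrix.mul_diagonal]
  simp only [suppPow_apply hA.1, Matrix.smul_apply, h, smul_eq_mul, Finset.mul_sum]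
  refine HasDerivAt.fun_sum fun x _ => ?_
  split_ifs with h0
  · simpa using hasDerivAt_const z (0 : ℂ)
  · have h1 : HasDerivAt (fun w => a * w + b) a z := by
      simpa using ((hasDerivAt_id z).const_mul a).add_const b
    have h2 := h1.const_cpow (c := (hA.1.eigenvalues x : ℂ)) (Or.inl (by exact_mod_cast h0))
    have h3 := (h2.const_mul ((hA.1.eigenvectorUnitary : Matrix p p ℂ) i x)).mul_const
      (star ((hA.1.eigenvectorUnitary : Matrix p p ℂ) j x))
    refine h3.congr_deriv ?_
    rw [Complex.ofReal_log (hA.eigenvalues_nonneg x)]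
    ring

/-- For real `a` the modulus of `λ^{az+b}` with `λ > 0` depends only on `Re z`, which is bounded on
the strip. -/
theorem boundedOnStrip_suppPow {A : Matrix p p ℂ} (hA : A.PosSemidef) {a : ℂ} (ha : a.im = 0)
    (b : ℂ) : BoundedOnStrip fun w => suppPow A (a * w + b) := by
  intro i j
  refine ⟨∑ x, ‖(hA.1.eigenvectorUnitary : Matrix p p ℂ) i x‖ *
    Real.exp (|Real.log (hA.1.eigenvalues x)| * (|a.re| + |b.re|)) *
    ‖star ((hA.1.eigenvectorUnitary : Matrix p p ℂ) j x)‖, fun z hz => ?_⟩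
  beta_reduce
  rw [suppPow_apply hA.1]
  refine (norm_sum_le _ _).trans (Finset.sum_le_sum fun x _ => ?_)
  rw [norm_mul, norm_mul]
  gcongr
  split_ifs with h0
  · simpa using (Real.exp_pos _).le
  · have hpos : 0 < hA.1.eigenvalues x := lt_of_le_of_ne (hA.eigenvalues_nonneg x) (Ne.symm h0)
    rw [Complex.norm_cpow_eq_rpow_re_of_pos hpos, Real.rpow_def_of_pos hpos, Real.exp_le_exp]
    refine (le_abs_self _).trans ?_
    rw [abs_mul]
    gcongr
    have : (a * z + b).re = a.re * z.re + b.re := by simp [ha]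
    rw [this]
    refine (abs_add_le _ _).trans ?_
    rw [abs_mul]
    gcongr
    exact mul_le_of_le_one_right (abs_nonneg _) hz

end Calculus

/-! ### Frobenius norm, Cauchy–Schwarz and partial isometries. -/

section Frobenius

variable {p q r : Type*} [Fintype p] [Fintype q] [Fintype r]

/-- The squared Frobenius norm. -/
def frobSq (X : Matrix p q ℂ) : ℝ := (Xᴴ * X).trace.re

theorem trace_conjTranspose_mul_eq_inner (X Y : Matrix p q ℂ) :
    (Xᴴ * Y).trace = inner ℂ (WithLp.toLp 2 fun i : q × p => X i.2 i.1)
      (WithLp.toLp 2 fun i : q × p => Y i.2 i.1) := by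
  simp [Matrix.trace, Matrix.mul_apply, PiLp.inner_apply, Fintype.sum_prod_type, mul_comm]

theorem frobSq_eq_norm_sq (X : Matrix p q ℂ) :
    frobSq X = ‖(WithLp.toLp 2 fun i : q × p => X i.2 i.1 : EuclideanSpace ℂ (q × p))‖ ^ 2 := by
  rw [frobSq, trace_conjTranspose_mul_eq_inner, inner_self_eq_norm_sq_to_K]
  norm_cast

theorem frobSq_nonneg (X : Matrix p q ℂ) : 0 ≤ frobSq X := by
  rw [frobSq_eq_norm_sq]
  positivity

theorem norm_trace_conjTranspose_mul_sq_le (X Y : Matrix p q ℂ) :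
    ‖(Xᴴ * Y).trace‖ ^ 2 ≤ frobSq X * frobSq Y := by
  rw [frobSq_eq_norm_sq, frobSq_eq_norm_sq, trace_conjTranspose_mul_eq_inner, ← mul_pow]
  gcongr
  exact norm_inner_le_norm _ _

/-- Pythagoras for a partial isometry: the loss of squared norm is exactly that of `(1 - P) X`. It
is applied to imaginary powers. -/
theorem frobSq_mul_le [DecidableEq q] {C : Matrix p q ℂ} {P : Matrix q q ℂ} (hC : Cᴴ * C = P)
    (hP : Pᴴ = P) (hPP : P * P = P) (X : Matrix q r ℂ) : frobSq (C * X) ≤ frobSq X := by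
  have h : frobSq ((1 - P) * X) = frobSq X - frobSq (C * X) := by
    have h1 : (1 - P)ᴴ * (1 - P) = 1 - P := by
      rw [conjTranspose_sub, conjTranspose_one, hP, Matrix.sub_mul, Matrix.mul_sub, Matrix.mul_sub, hPP]
      simp
    rw [frobSq, frobSq, frobSq, conjTranspose_mul, conjTranspose_mul, Matrix.mul_assoc,
      ← Matrix.mul_assoc _ _ X, h1, Matrix.mul_assoc, ← Matrix.mul_assoc _ C, hC, Matrix.sub_mul,
      Matrix.mul_sub, Matrix.one_mul, trace_sub, Complex.sub_re]
  linarith [frobSq_nonneg ((1 - P) * X)]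

end Frobenius

/-- If `g` is entire and bounded on a strip with `g 0 = 1`, and is bounded by `1` and by `exp c` on
the two boundary lines, then its logarithmic derivative at `0` is at most `c`. -/
theorem re_deriv_le_of_three_lines {g : ℂ → ℂ} {g' : ℂ} {c C : ℝ} (hd : Differentiable ℂ g)
    (hg' : HasDerivAt g g' 0) (hg0 : g 0 = 1)
    (hC : ∀ z : ℂ, |z.re| ≤ 1 → ‖g z‖ ≤ C)
    (h0 : ∀ t : ℝ, ‖g (Complex.I * t)‖ ≤ 1)
    (h1 : ∀ t : ℝ, ‖g (1 + Complex.I * t)‖ ≤ Real.exp c) : g'.re ≤ c := by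
  have key : ∀ x : ℝ, 0 < x → x ≤ 1 → (g x).re ≤ Real.exp (c * x) := by
    intro x hx hx1
    have hmem : (x : ℂ) ∈ Complex.HadamardThreeLines.verticalClosedStrip 0 1 := by
      simp [Complex.HadamardThreeLines.verticalClosedStrip, hx.le, hx1]
    have h := Complex.HadamardThreeLines.norm_le_interp_of_mem_verticalClosedStrip₀₁' g
      (a := 1) (b := Real.exp c) hmem hd.diffContOnCl ?_ ?_ ?_
    · refine (Complex.re_le_norm _).trans (h.trans_eq ?_)
      rw [Real.one_rpow, one_mul, Complex.ofReal_re, ← Real.exp_mul]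
    · refine ⟨C, ?_⟩
      rintro _ ⟨z, hz, rfl⟩
      have hz' : 0 ≤ z.re ∧ z.re ≤ 1 := hz
      exact hC z (abs_le.2 ⟨by linarith, hz'.2⟩)
    · intro z hz
      have hz' : z.re = 0 := hz
      have : z = Complex.I * (z.im : ℝ) := by
        apply Complex.ext <;> simp [hz']
      rw [this]
      exact h0 _
    · intro z hz
      have hz' : z.re = 1 := hz
      have : z = 1 + Complex.I * (z.im : ℝ) := by
        apply Complex.ext <;> simp [hz']
      rw [this]
      exact h1 _
  have hr : HasDerivAt (fun x : ℝ => (g x).re) g'.re 0 := by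
    have hg'' : HasDerivAt g g' ((0 : ℝ) : ℂ) := by simpa using hg'
    exact hg''.real_of_complex
  have he : HasDerivAt (fun x : ℝ => Real.exp (c * x)) c 0 := by
    have := ((hasDerivAt_id (0 : ℝ)).const_mul c).exp
    simpa using this
  -- `exp (c x) - Re g(x)` vanishes at `0` and is non-negative on `(0, 1]`, so its right slope at
  -- `0` is non-negative.
  have hs := (he.sub hr).tendsto_slope_zero_right
  have hnn : 0 ≤ c - g'.re := by
    refine ge_of_tendsto hs ?_
    filter_upwards [Ioc_mem_nhdsGT (zero_lt_one (α := ℝ))] with x hx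
    have h2 := key x hx.1 hx.2
    simp only [zero_add, smul_eq_mul, Pi.sub_apply, mul_zero, Real.exp_zero, Complex.ofReal_zero,
      hg0, Complex.one_re, sub_self, sub_zero]
    exact mul_nonneg (inv_nonneg.2 hx.1.le) (by linarith)
  linarith

/-- The rotations merge with the square roots in the Petz map because powers of one operator add
their exponents. -/
theorem rotatedPetzMap_eq {n m : Type*} [Fintype n] [DecidableEq n] [Fintype m] [DecidableEq m]
    {σ : Matrix n n ℂ} {Φ : Matrix n n ℂ →ₗ[ℂ] Matrix m m ℂ} (hσ : σ.PosSemidef)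
    (hΦσ : (Φ σ).PosSemidef) (t : ℝ) (Y : Matrix m m ℂ) :
    rotatedPetzMap σ Φ t Y = suppPow σ (1 / 2 + Complex.I * t) *
      hsAdjoint Φ (suppPow (Φ σ) (-(1 / 2) - Complex.I * t) * Y *
        suppPow (Φ σ) (-(1 / 2) + Complex.I * t)) * suppPow σ (1 / 2 - Complex.I * t) := by
  simp only [rotatedPetzMap, rotation, petzMap, Matrix.mul_assoc, suppPow_mul_suppPow hσ,
    suppPow_mul_suppPow hΦσ, suppPow_mul_suppPow_assoc hσ, suppPow_mul_suppPow_assoc hΦσ]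
  push_cast
  ring_nf

/-! ### The interpolating holomorphic family and its boundary values. -/

section PetzCurve

variable {n b e : Type*} [Fintype n] [DecidableEq n] [Fintype b] [Fintype e]
  {U : Matrix (b × e) n ℂ} {ρ σ : Matrix n n ℂ}

theorem suppPow_half_mul_suppPow_half (hρ : ρ.PosSemidef) :
    suppPow ρ (1 / 2) * suppPow ρ (1 / 2) = ρ := by
  rw [suppPow_mul_suppPow hρ, add_halves, suppPow_one hρ.1]

theorem conjTranspose_suppPow_half (hρ : ρ.PosSemidef) :
    (suppPow ρ (1 / 2))ᴴ = suppPow ρ (1 / 2) := by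
  rw [conjTranspose_suppPow hρ]
  norm_num

theorem frobSq_mul_suppPow_half (hρ : ρ.PosSemidef) (hU : Uᴴ * U = 1) (htr : ρ.trace = 1) :
    frobSq (U * suppPow ρ (1 / 2)) = 1 := by
  rw [frobSq, conjTranspose_mul, Matrix.mul_assoc, ← Matrix.mul_assoc _ U, hU, Matrix.one_mul,
    conjTranspose_suppPow_half hρ, suppPow_half_mul_suppPow_half hρ, htr, Complex.one_re]

theorem suppPow_zero_mul_suppPow_half (hρ : ρ.PosSemidef) (hs : suppPow σ 0 * ρ = ρ) :
    suppPow σ 0 * suppPow ρ (1 / 2) = suppPow ρ (1 / 2) := by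
  have h : suppPow ρ (1 / 2) = ρ * suppPow ρ (-(1 / 2)) := by
    rw [self_mul_suppPow hρ.1]
    norm_num
  rw [h, ← Matrix.mul_assoc, hs]

variable [DecidableEq e]

theorem trace_conjTranspose_mul_ampliation_mul (hρ : ρ.PosSemidef) (Y : Matrix b b ℂ) :
    ((U * suppPow ρ (1 / 2))ᴴ * (ampliation e Y * (U * suppPow ρ (1 / 2)))).trace =
      (dilationMap U ρ * Y).trace := by
  rw [Matrix.trace_mul_comm, Matrix.mul_assoc, conjTranspose_mul, conjTranspose_suppPow_half hρ,
    Matrix.mul_assoc U, ← Matrix.mul_assoc _ _ Uᴴ, suppPow_half_mul_suppPow_half hρ,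
    ← Matrix.mul_assoc U, ← trace_mul_dilationMap, Matrix.trace_mul_comm]

variable [DecidableEq b]

/-- Factoring `ρ^{1/2}` through `σ^{1/2}` reduces this to the support property of `U σ^{1/2}`. -/
theorem ampliation_suppPow_zero_mul_of_supp_le (hρ : ρ.PosSemidef) (hσ : σ.PosSemidef)
    (hs : suppPow σ 0 * ρ = ρ) :
    ampliation e (suppPow (dilationMap U σ) 0) * (U * suppPow ρ (1 / 2)) =
      U * suppPow ρ (1 / 2) := by
  have h : U * suppPow ρ (1 / 2) =
      (U * suppPow σ (1 / 2)) * (suppPow σ (-(1 / 2)) * suppPow ρ (1 / 2)) := by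
    rw [Matrix.mul_assoc, suppPow_mul_suppPow_assoc hσ, add_neg_cancel,
      suppPow_zero_mul_suppPow_half hρ hs]
  rw [h, ← Matrix.mul_assoc, ampliation_suppPow_zero_mul U hσ]

/-- The channel preserves inclusion of supports, so the second relative entropy is finite as well.
-/
theorem suppPow_zero_dilationMap_mul (hρ : ρ.PosSemidef) (hσ : σ.PosSemidef)
    (hs : suppPow σ 0 * ρ = ρ) :
    suppPow (dilationMap U σ) 0 * dilationMap U ρ = dilationMap U ρ := by
  refine dilationMap_eq_of_ampliation_mul U ρ _ ?_
  have h : U * ρ = U * suppPow ρ (1 / 2) * suppPow ρ (1 / 2) := by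
    rw [Matrix.mul_assoc, suppPow_half_mul_suppPow_half hρ]
  rw [h, ← Matrix.mul_assoc, ampliation_suppPow_zero_mul_of_supp_le hρ hσ hs]

/-- The holomorphic family
`(N(ρ)^{z/2} N(σ)^{-z/2} ⊗ 1) U σ^{z/2} ρ^{(1-z)/2}` with `N(θ) = Tr_E {U θ Uᴴ}`, interpolating
between the operators whose Frobenius norms give the recovery quantities. -/
def petzCurve (U : Matrix (b × e) n ℂ) (ρ σ : Matrix n n ℂ) (z : ℂ) : Matrix (b × e) n ℂ :=
  ampliation e (suppPow (dilationMap U ρ) (1 / 2 * z + 0) *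
      suppPow (dilationMap U σ) (-(1 / 2) * z + 0)) *
    (U * (suppPow σ (1 / 2 * z + 0) * suppPow ρ (-(1 / 2) * z + 1 / 2)))

/-- The overlap of `petzCurve` with its value at `0`. -/
def petzOverlap (U : Matrix (b × e) n ℂ) (ρ σ : Matrix n n ℂ) (z : ℂ) : ℂ :=
  ((U * suppPow ρ (1 / 2))ᴴ * petzCurve U ρ σ z).trace

theorem petzCurve_zero (hρ : ρ.PosSemidef) (hσ : σ.PosSemidef) (hs : suppPow σ 0 * ρ = ρ) :
    petzCurve U ρ σ 0 = U * suppPow ρ (1 / 2) := by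
  simp only [petzCurve, mul_zero, zero_add]
  rw [suppPow_zero_mul_suppPow_half hρ hs, ampliation_mul, Matrix.mul_assoc,
    ampliation_suppPow_zero_mul_of_supp_le hρ hσ hs, ampliation_suppPow_zero_mul U hρ]

theorem petzOverlap_zero (hρ : ρ.PosSemidef) (hσ : σ.PosSemidef) (hs : suppPow σ 0 * ρ = ρ)
    (hU : Uᴴ * U = 1) (htr : ρ.trace = 1) : petzOverlap U ρ σ 0 = 1 := by
  rw [petzOverlap, petzCurve_zero hρ hσ hs, conjTranspose_mul, Matrix.mul_assoc,
    ← Matrix.mul_assoc _ U, hU, Matrix.one_mul, conjTranspose_suppPow_half hρ,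
    suppPow_half_mul_suppPow_half hρ, htr]

theorem hasEntryDerivAt_petzCurve (hρ : ρ.PosSemidef) (hσ : σ.PosSemidef) (z : ℂ) :
    HasEntryDerivAt (petzCurve U ρ σ)
      (ampliation e
          ((1 / 2 : ℂ) • (suppLog (dilationMap U ρ) * suppPow (dilationMap U ρ) (1 / 2 * z + 0)) *
              suppPow (dilationMap U σ) (-(1 / 2) * z + 0) +
            suppPow (dilationMap U ρ) (1 / 2 * z + 0) * (-(1 / 2) : ℂ) •
              (suppLog (dilationMap U σ) * suppPow (dilationMap U σ) (-(1 / 2) * z + 0))) *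
          (U * (suppPow σ (1 / 2 * z + 0) * suppPow ρ (-(1 / 2) * z + 1 / 2))) +
        ampliation e (suppPow (dilationMap U ρ) (1 / 2 * z + 0) *
            suppPow (dilationMap U σ) (-(1 / 2) * z + 0)) *
          ((0 : Matrix (b × e) n ℂ) * (suppPow σ (1 / 2 * z + 0) * suppPow ρ (-(1 / 2) * z + 1 / 2)) +
            U * ((1 / 2 : ℂ) • (suppLog σ * suppPow σ (1 / 2 * z + 0)) *
                suppPow ρ (-(1 / 2) * z + 1 / 2) +
              suppPow σ (1 / 2 * z + 0) * (-(1 / 2) : ℂ) •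
                (suppLog ρ * suppPow ρ (-(1 / 2) * z + 1 / 2))))) z :=
  HasEntryDerivAt.mul
    (HasEntryDerivAt.ampliation
      ((hasEntryDerivAt_suppPow (posSemidef_dilationMap U hρ) (1 / 2) 0 z).mul
        (hasEntryDerivAt_suppPow (posSemidef_dilationMap U hσ) (-(1 / 2)) 0 z)))
    ((hasEntryDerivAt_const U z).mul
      ((hasEntryDerivAt_suppPow hσ (1 / 2) 0 z).mul
        (hasEntryDerivAt_suppPow hρ (-(1 / 2)) (1 / 2) z)))

theorem differentiable_petzOverlap (hρ : ρ.PosSemidef) (hσ : σ.PosSemidef) :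
    Differentiable ℂ (petzOverlap U ρ σ) := fun z =>
  ((hasEntryDerivAt_const _ z).mul (hasEntryDerivAt_petzCurve hρ hσ z)).trace.differentiableAt

theorem exists_norm_petzOverlap_le (hρ : ρ.PosSemidef) (hσ : σ.PosSemidef) :
    ∃ C : ℝ, ∀ z : ℂ, |z.re| ≤ 1 → ‖petzOverlap U ρ σ z‖ ≤ C := by
  have h1 : (1 / 2 : ℂ).im = 0 := by norm_num
  have h2 : (-(1 / 2) : ℂ).im = 0 := by norm_num
  exact BoundedOnStrip.trace <| (boundedOnStrip_const _).mul <| BoundedOnStrip.mul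
    (BoundedOnStrip.ampliation
      ((boundedOnStrip_suppPow (posSemidef_dilationMap U hρ) h1 0).mul
        (boundedOnStrip_suppPow (posSemidef_dilationMap U hσ) h2 0)))
    ((boundedOnStrip_const U).mul
      ((boundedOnStrip_suppPow hσ h1 0).mul (boundedOnStrip_suppPow hρ h2 (1 / 2))))

/-- The product rule yields one logarithm from each of the four powers; the zeroth powers left over
are support projections, absorbed by `U ρ^{1/2}` or its adjoint. -/
theorem hasDerivAt_petzOverlap_zero (hρ : ρ.PosSemidef) (hσ : σ.PosSemidef)
    (hs : suppPow σ 0 * ρ = ρ) (hU : Uᴴ * U = 1) :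
    HasDerivAt (petzOverlap U ρ σ)
      (1 / 2 * ((dilationMap U ρ * (suppLog (dilationMap U ρ) - suppLog (dilationMap U σ))).trace -
        (ρ * (suppLog ρ - suppLog σ)).trace)) 0 := by
  have hA := posSemidef_dilationMap U hρ
  have hB := posSemidef_dilationMap U hσ
  refine ((hasEntryDerivAt_const _ 0).mul
    (hasEntryDerivAt_petzCurve hρ hσ 0)).trace.congr_deriv ?_
  have hXA := ampliation_suppPow_zero_mul U hρ
  have hXB := ampliation_suppPow_zero_mul_of_supp_le (U := U) hρ hσ hs
  have hσρ := suppPow_zero_mul_suppPow_half hρ hs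
  have hXA' : (U * suppPow ρ (1 / 2))ᴴ * ampliation e (suppPow (dilationMap U ρ) 0) =
      (U * suppPow ρ (1 / 2))ᴴ := by
    conv_rhs => rw [← hXA, conjTranspose_mul, conjTranspose_ampliation, conjTranspose_suppPow hA,
      star_zero]
  have hXB' : (U * suppPow ρ (1 / 2))ᴴ * ampliation e (suppPow (dilationMap U σ) 0) =
      (U * suppPow ρ (1 / 2))ᴴ := by
    conv_rhs => rw [← hXB, conjTranspose_mul, conjTranspose_ampliation, conjTranspose_suppPow hB,
      star_zero]
  have hXU : (U * suppPow ρ (1 / 2))ᴴ * U = suppPow ρ (1 / 2) := by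
    rw [conjTranspose_mul, Matrix.mul_assoc, hU, Matrix.mul_one, conjTranspose_suppPow_half hρ]
  have hρσ : suppPow ρ (1 / 2) * suppPow σ 0 = suppPow ρ (1 / 2) := by
    have := congrArg conjTranspose hσρ
    rwa [conjTranspose_mul, conjTranspose_suppPow_half hρ, conjTranspose_suppPow hσ,
      star_zero] at this
  have t1 := trace_conjTranspose_mul_ampliation_mul (U := U) hρ (suppLog (dilationMap U ρ))
  have t2 := trace_conjTranspose_mul_ampliation_mul (U := U) hρ (suppLog (dilationMap U σ))
  set A := dilationMap U ρ
  set B := dilationMap U σ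
  set X := U * suppPow ρ (1 / 2) with hX
  have e1 : Xᴴ * (ampliation e (suppLog A * suppPow A 0 * suppPow B 0) * X) =
      Xᴴ * (ampliation e (suppLog A) * X) := by
    rw [ampliation_mul, ampliation_mul, Matrix.mul_assoc, hXB, Matrix.mul_assoc, hXA]
  have e2 : Xᴴ * (ampliation e (suppPow A 0 * (suppLog B * suppPow B 0)) * X) =
      Xᴴ * (ampliation e (suppLog B) * X) := by
    rw [ampliation_mul, ampliation_mul, Matrix.mul_assoc (ampliation e (suppPow A 0)),
      ← Matrix.mul_assoc Xᴴ, hXA', Matrix.mul_assoc _ _ X, hXB]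
  have e3 : (Xᴴ * (ampliation e (suppPow A 0 * suppPow B 0) *
      (U * (suppLog σ * suppPow σ 0 * suppPow ρ (1 / 2))))).trace = (ρ * suppLog σ).trace := by
    rw [ampliation_mul, Matrix.mul_assoc (ampliation e (suppPow A 0)), ← Matrix.mul_assoc Xᴴ, hXA',
      ← Matrix.mul_assoc Xᴴ, hXB', ← Matrix.mul_assoc Xᴴ, hXU, Matrix.mul_assoc (suppLog σ), hσρ, ← Matrix.mul_assoc, Matrix.trace_mul_comm,
      ← Matrix.mul_assoc, suppPow_half_mul_suppPow_half hρ]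
  have e4 : (Xᴴ * (ampliation e (suppPow A 0 * suppPow B 0) *
      (U * (suppPow σ 0 * (suppLog ρ * suppPow ρ (1 / 2)))))).trace = (ρ * suppLog ρ).trace := by
    rw [ampliation_mul, Matrix.mul_assoc (ampliation e (suppPow A 0)), ← Matrix.mul_assoc Xᴴ, hXA',
      ← Matrix.mul_assoc Xᴴ, hXB', ← Matrix.mul_assoc Xᴴ, hXU, ← Matrix.mul_assoc, hρσ, ← Matrix.mul_assoc, Matrix.trace_mul_comm,
      ← Matrix.mul_assoc, suppPow_half_mul_suppPow_half hρ]
  simp only [mul_zero, zero_add, Matrix.zero_mul, ampliation_add, ampliation_smul, hσρ,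
    Matrix.mul_add, Matrix.add_mul, Matrix.smul_mul, Matrix.mul_smul, trace_add, trace_smul, ← hX, e1, e2, e3, e4,
    t1, t2, smul_eq_mul, Matrix.mul_sub, trace_sub]
  ring

theorem norm_petzOverlap_sq_le (hρ : ρ.PosSemidef) (hU : Uᴴ * U = 1) (htr : ρ.trace = 1) (z : ℂ) :
    ‖petzOverlap U ρ σ z‖ ^ 2 ≤ frobSq (petzCurve U ρ σ z) := by
  refine (norm_trace_conjTranspose_mul_sq_le _ _).trans_eq ?_
  rw [frobSq_mul_suppPow_half hρ hU htr, one_mul]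

theorem frobSq_suppPow_mul_le {r : Type*} [Fintype r] (hρ : ρ.PosSemidef) {z : ℂ}
    (hz : star z = -z) (X : Matrix n r ℂ) : frobSq (suppPow ρ z * X) ≤ frobSq X := by
  refine frobSq_mul_le (P := suppPow ρ 0) ?_ ?_ ?_ X
  · rw [conjTranspose_suppPow hρ, suppPow_mul_suppPow hρ, hz, neg_add_cancel]
  · rw [conjTranspose_suppPow hρ, star_zero]
  · rw [suppPow_mul_suppPow hρ, zero_add]

theorem frobSq_ampliation_suppPow_mul_le {r : Type*} [Fintype r] {A : Matrix b b ℂ}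
    (hA : A.PosSemidef) {z : ℂ} (hz : star z = -z) (X : Matrix (b × e) r ℂ) :
    frobSq (ampliation e (suppPow A z) * X) ≤ frobSq X := by
  refine frobSq_mul_le (P := ampliation e (suppPow A 0)) ?_ ?_ ?_ X
  · rw [conjTranspose_ampliation, ← ampliation_mul, conjTranspose_suppPow hA,
      suppPow_mul_suppPow hA, hz, neg_add_cancel]
  · rw [conjTranspose_ampliation, conjTranspose_suppPow hA, star_zero]
  · rw [← ampliation_mul, suppPow_mul_suppPow hA, zero_add]

theorem frobSq_petzCurve_I_mul_le (hρ : ρ.PosSemidef) (hσ : σ.PosSemidef) (hU : Uᴴ * U = 1)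
    (htr : ρ.trace = 1) (t : ℝ) : frobSq (petzCurve U ρ σ (Complex.I * t)) ≤ 1 := by
  have h1 : star (1 / 2 * (Complex.I * t) + 0) = -(1 / 2 * (Complex.I * t) + 0) := by simp
  have h2 : star (-(1 / 2) * (Complex.I * t) + 0) = -(-(1 / 2) * (Complex.I * t) + 0) := by simp
  have hU1 : ∀ X : Matrix n n ℂ, frobSq (U * X) = frobSq X := by
    intro X
    rw [frobSq, frobSq, conjTranspose_mul, Matrix.mul_assoc, ← Matrix.mul_assoc _ U, hU,
      Matrix.one_mul]
  have h3 : suppPow ρ (-(1 / 2) * (Complex.I * t) + 1 / 2) =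
      suppPow ρ (-(1 / 2) * (Complex.I * t) + 0) * suppPow ρ (1 / 2) := by
    rw [suppPow_mul_suppPow hρ, add_zero]
  rw [petzCurve, ampliation_mul, Matrix.mul_assoc, h3]
  refine (frobSq_ampliation_suppPow_mul_le (posSemidef_dilationMap U hρ) h1 _).trans ?_
  refine (frobSq_ampliation_suppPow_mul_le (posSemidef_dilationMap U hσ) h2 _).trans ?_
  rw [hU1]
  refine (frobSq_suppPow_mul_le hσ h1 _).trans ((frobSq_suppPow_mul_le hρ h2 _).trans ?_)
  rw [← hU1, frobSq_mul_suppPow_half hρ hU htr]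

/-- The conjugated product of the operators in `petzCurve`, for general exponents. -/
theorem frobSq_ampliation_mul (hρ : ρ.PosSemidef) (hσ : σ.PosSemidef) (u v w : ℂ) :
    frobSq (ampliation e (suppPow (dilationMap U ρ) u * suppPow (dilationMap U σ) w) *
      (U * (suppPow σ (-w) * suppPow ρ v))) =
    (suppPow ρ (v + star v) * (suppPow σ (-star w) * (Uᴴ * ampliation e
      (suppPow (dilationMap U σ) (star w) * suppPow (dilationMap U ρ) (star u + u) *
        suppPow (dilationMap U σ) w) * U) * suppPow σ (-w))).trace.re := by
  have hA := posSemidef_dilationMap U hρ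
  have hB := posSemidef_dilationMap U hσ
  rw [← suppPow_mul_suppPow hρ, Matrix.mul_assoc (suppPow ρ v), Matrix.trace_mul_comm (suppPow ρ v),
    ← suppPow_mul_suppPow hA, frobSq]
  simp only [conjTranspose_mul, conjTranspose_ampliation, conjTranspose_suppPow hρ,
    conjTranspose_suppPow hσ, conjTranspose_suppPow hA, conjTranspose_suppPow hB, star_neg,
    ampliation_mul, Matrix.mul_assoc]

/-- In the product with the adjoint, the exponents of `ρ` sum to `0` and those of `N(ρ)` to `1`,
while the imaginary parts on `σ` and `N(σ)` survive as a rotation by `-t/2`. -/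
theorem frobSq_petzCurve_one_add (hρ : ρ.PosSemidef) (hσ : σ.PosSemidef) (t : ℝ) :
    frobSq (petzCurve U ρ σ (1 + Complex.I * t)) =
      (suppPow ρ 0 *
        rotatedPetzMap σ (dilationMap U) (-t / 2) (dilationMap U ρ)).trace.re := by
  have hA := posSemidef_dilationMap U hρ
  have hB := posSemidef_dilationMap U hσ
  have h := frobSq_ampliation_mul (U := U) hρ hσ (1 / 2 * (1 + Complex.I * t) + 0)
    (-(1 / 2) * (1 + Complex.I * t) + 1 / 2) (-(1 / 2) * (1 + Complex.I * t) + 0)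
  have hw : -(-(1 / 2) * (1 + Complex.I * t) + 0) = 1 / 2 * (1 + Complex.I * t) + 0 := by ring
  have hsw : star (-(1 / 2) * (1 + Complex.I * t) + 0 : ℂ) = -(1 / 2) * (1 - Complex.I * t) := by
    simp [sub_eq_add_neg]
  rw [hw] at h
  rw [petzCurve, h, rotatedPetzMap_eq hσ hB, hsAdjoint_dilationMap, hsw]
  have e1 : (-(1 / 2) * (1 + Complex.I * t) + 1 / 2 +
      star (-(1 / 2) * (1 + Complex.I * t) + 1 / 2) : ℂ) = 0 := by
    simp
    ring
  have e2 : (star (1 / 2 * (1 + Complex.I * t) + 0) + (1 / 2 * (1 + Complex.I * t) + 0) : ℂ)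
      = 1 := by
    simp
    ring
  rw [e1, e2, suppPow_one hA.1]
  push_cast
  ring_nf

theorem suppPow_mul_suppPow_eq_one (hρ : ρ.PosDef) {z w : ℂ} (h : z + w = 0) :
    suppPow ρ z * suppPow ρ w = 1 := by
  rw [suppPow_mul_suppPow hρ.posSemidef, h, suppPow_zero_eq_one hρ]

/-- The inverse of a rotated Petz recovery map of a unitary dilation applied to `N(ρ)`. -/
theorem suppPow_rotatedPetzMap (hσ : σ.PosDef) (hA : (dilationMap U ρ).PosDef)
    (hB : (dilationMap U σ).PosDef) (hU : Uᴴ * U = 1) (hU' : U * Uᴴ = 1) (t : ℝ) :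
    suppPow (rotatedPetzMap σ (dilationMap U) t (dilationMap U ρ)) (-1) =
      suppPow σ (-(1 / 2) + Complex.I * t) * (Uᴴ * ampliation e
        (suppPow (dilationMap U σ) (1 / 2 - Complex.I * t) * suppPow (dilationMap U ρ) (-1) *
          suppPow (dilationMap U σ) (1 / 2 + Complex.I * t)) * U) *
        suppPow σ (-(1 / 2) - Complex.I * t) := by
  have hσ' := hσ.posSemidef
  have hA' := hA.posSemidef
  have hB' := hB.posSemidef
  have hAA : suppPow (dilationMap U ρ) (-1) * dilationMap U ρ = 1 := by
    rw [suppPow_mul_self hA.1, neg_add_cancel, suppPow_zero_eq_one hA]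
  refine suppPow_neg_one_eq ?_ ?_
  · rw [rotatedPetzMap_eq hσ' hB', hsAdjoint_dilationMap, Matrix.IsHermitian]
    simp only [conjTranspose_mul, conjTranspose_ampliation, conjTranspose_conjTranspose,
      conjTranspose_suppPow hσ', conjTranspose_suppPow hB', hA.1.eq, Matrix.mul_assoc]
    simp [sub_eq_add_neg]
  -- For unitary `U` the adjoint `Y ↦ Uᴴ (Y ⊗ 1) U` is multiplicative, so the factors cancel in
  -- pairs.
  · rw [rotatedPetzMap_eq hσ' hB', hsAdjoint_dilationMap]
    set A := dilationMap U ρ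
    set B := dilationMap U σ
    have hYX : ampliation e (suppPow B (1 / 2 - Complex.I * t) * suppPow A (-1) *
          suppPow B (1 / 2 + Complex.I * t)) *
        ampliation e (suppPow B (-(1 / 2) - Complex.I * t) * A *
          suppPow B (-(1 / 2) + Complex.I * t)) = 1 := by
      rw [← ampliation_mul]
      simp only [Matrix.mul_assoc]
      rw [← Matrix.mul_assoc (suppPow B _) (suppPow B _),
        suppPow_mul_suppPow_eq_one hB (by ring), Matrix.one_mul, ← Matrix.mul_assoc _ A, hAA,
        Matrix.one_mul, suppPow_mul_suppPow_eq_one hB (by ring), ampliation_one]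
    generalize ampliation e (suppPow B (1 / 2 - Complex.I * t) * suppPow A (-1) *
          suppPow B (1 / 2 + Complex.I * t)) = Y at hYX ⊢
    generalize ampliation e (suppPow B (-(1 / 2) - Complex.I * t) * A *
          suppPow B (-(1 / 2) + Complex.I * t)) = X at hYX ⊢
    simp only [Matrix.mul_assoc]
    rw [← Matrix.mul_assoc (suppPow σ _) (suppPow σ _), suppPow_mul_suppPow_eq_one hσ (by ring),
      Matrix.one_mul, ← Matrix.mul_assoc U, hU', Matrix.one_mul, ← Matrix.mul_assoc Y, hYX,
      Matrix.one_mul, ← Matrix.mul_assoc Uᴴ, hU, Matrix.one_mul,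
      suppPow_mul_suppPow_eq_one hσ (by ring)]

/-- Here the exponents of `ρ` sum to `2` and those of `N(ρ)` to `-1`, which matches the inverse of
the recovered operator. -/
theorem frobSq_petzCurve_neg_one_add (hρ : ρ.PosSemidef) (hσ : σ.PosDef)
    (hA : (dilationMap U ρ).PosDef) (hB : (dilationMap U σ).PosDef) (hU : Uᴴ * U = 1)
    (hU' : U * Uᴴ = 1) (t : ℝ) :
    frobSq (petzCurve U ρ σ (-1 + Complex.I * t)) =
      (suppPow ρ 2 * suppPow (rotatedPetzMap σ (dilationMap U) (-t / 2) (dilationMap U ρ))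
        (-1)).trace.re := by
  have h := frobSq_ampliation_mul (U := U) hρ hσ.posSemidef (1 / 2 * (-1 + Complex.I * t) + 0)
    (-(1 / 2) * (-1 + Complex.I * t) + 1 / 2) (-(1 / 2) * (-1 + Complex.I * t) + 0)
  have hw : -(-(1 / 2) * (-1 + Complex.I * t) + 0) = 1 / 2 * (-1 + Complex.I * t) + 0 := by ring
  have hsw : star (-(1 / 2) * (-1 + Complex.I * t) + 0 : ℂ) =
      -(1 / 2) * (-1 - Complex.I * t) := by
    simp [sub_eq_add_neg]
  rw [hw] at h
  rw [petzCurve, h, (suppPow_rotatedPetzMap hσ hA hB hU hU' _), hsw]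
  have e1 : (-(1 / 2) * (-1 + Complex.I * t) + 1 / 2 +
      star (-(1 / 2) * (-1 + Complex.I * t) + 1 / 2) : ℂ) = 2 := by
    simp
    ring
  have e2 : (star (1 / 2 * (-1 + Complex.I * t) + 0) + (1 / 2 * (-1 + Complex.I * t) + 0) : ℂ)
      = -1 := by
    simp
    ring
  rw [e1, e2]
  push_cast
  ring_nf

end PetzCurve

/-! ### Recoverability bounds, first for reals and then in `EReal`. -/

section Recoverability

variable {n b e : Type*} [Fintype n] [DecidableEq n] [Fintype b] [DecidableEq b] [Fintype e]
  [DecidableEq e] {U : Matrix (b × e) n ℂ} {ρ σ : Matrix n n ℂ}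

theorem norm_petzOverlap_le_exp (hρ : ρ.PosSemidef) (hU : Uᴴ * U = 1) (htr : ρ.trace = 1)
    {z : ℂ} {r : ℝ} (h : frobSq (petzCurve U ρ σ z) ≤ Real.exp r) :
    ‖petzOverlap U ρ σ z‖ ≤ Real.exp (r / 2) := by
  refine le_of_sq_le_sq ((norm_petzOverlap_sq_le hρ hU htr z).trans (h.trans_eq ?_))
    (Real.exp_pos _).le
  rw [← Real.exp_nat_mul]
  push_cast
  ring_nf

theorem norm_petzOverlap_I_mul_le (hρ : ρ.PosSemidef) (hσ : σ.PosSemidef) (hU : Uᴴ * U = 1)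
    (htr : ρ.trace = 1) (t : ℝ) : ‖petzOverlap U ρ σ (Complex.I * t)‖ ≤ 1 := by
  have h := norm_petzOverlap_le_exp (U := U) (ρ := ρ) (σ := σ) (z := Complex.I * t) (r := 0)
    hρ hU htr (by
    rw [Real.exp_zero]
    exact frobSq_petzCurve_I_mul_le hρ hσ hU htr t)
  simpa using h

/-- The difference of relative entropies before and after the channel `θ ↦ Tr_E {U θ Uᴴ}`. -/
def relEntropyDiff (U : Matrix (b × e) n ℂ) (ρ σ : Matrix n n ℂ) : ℝ :=
  (ρ * (suppLog ρ - suppLog σ)).trace.re -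
    (dilationMap U ρ * (suppLog (dilationMap U ρ) - suppLog (dilationMap U σ))).trace.re

theorem relEntropy_sub_relEntropy (hρ : ρ.PosSemidef) (hσ : σ.PosSemidef)
    (hs : suppPow σ 0 * ρ = ρ) :
    relEntropy ρ σ - relEntropy (dilationMap U ρ) (dilationMap U σ) = (relEntropyDiff U ρ σ : ℝ) := by
  have h1 : supp ρ ≤ supp σ := (supp_le_supp_iff hρ.1 hσ).2 hs
  have h2 : supp (dilationMap U ρ) ≤ supp (dilationMap U σ) :=
    (supp_le_supp_iff (posSemidef_dilationMap U hρ).1 (posSemidef_dilationMap U hσ)).2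
      (suppPow_zero_dilationMap_mul hρ hσ hs)
  rw [relEntropy, relEntropy, if_pos h1, if_pos h2, relEntropyDiff, EReal.coe_sub]

theorem le_relEntropyDiff (hρ : ρ.PosSemidef) (htr : ρ.trace = 1) (hσ : σ.PosSemidef)
    (hs : suppPow σ 0 * ρ = ρ) (hU : Uᴴ * U = 1) {r : ℝ}
    (hr : ∀ t : ℝ, (suppPow ρ 0 *
      rotatedPetzMap σ (dilationMap U) t (dilationMap U ρ)).trace.re ≤ Real.exp (-r)) :
    r ≤ relEntropyDiff U ρ σ := by
  obtain ⟨C, hC⟩ := exists_norm_petzOverlap_le (U := U) hρ hσ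
  have h := re_deriv_le_of_three_lines (c := -r / 2) (differentiable_petzOverlap hρ hσ)
    (hasDerivAt_petzOverlap_zero hρ hσ hs hU) (petzOverlap_zero hρ hσ hs hU htr) hC
    (norm_petzOverlap_I_mul_le hρ hσ hU htr) fun t => norm_petzOverlap_le_exp hρ hU htr
      ((frobSq_petzCurve_one_add hρ hσ t).trans_le (by exact_mod_cast hr (-t / 2)))
  rw [show (1 / 2 : ℂ) = ((1 / 2 : ℝ) : ℂ) by push_cast; rfl, Complex.re_ofReal_mul,
    Complex.sub_re] at h
  rw [relEntropyDiff]
  linarith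

theorem relEntropyDiff_le (hρ : ρ.PosSemidef) (htr : ρ.trace = 1) (hσ : σ.PosDef)
    (hU : Uᴴ * U = 1) (hU' : U * Uᴴ = 1) (hA : (dilationMap U ρ).PosDef)
    (hB : (dilationMap U σ).PosDef) {r : ℝ}
    (hr : ∀ t : ℝ, (suppPow ρ 2 * suppPow
      (rotatedPetzMap σ (dilationMap U) t (dilationMap U ρ)) (-1)).trace.re ≤ Real.exp r) :
    relEntropyDiff U ρ σ ≤ r := by
  have hσ' := hσ.posSemidef
  have hs : suppPow σ 0 * ρ = ρ := by rw [suppPow_zero_eq_one hσ, Matrix.one_mul]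
  obtain ⟨C, hC⟩ := exists_norm_petzOverlap_le (U := U) hρ hσ'
  have hd := hasDerivAt_petzOverlap_zero hρ hσ' hs hU
  -- The base point becomes `-0`, as the chain rule for `z ↦ g(-z)` at `0` requires.
  rw [← neg_zero] at hd
  have hneg := hd.comp (0 : ℂ) (hasDerivAt_neg (0 : ℂ))
  have h := re_deriv_le_of_three_lines (c := r / 2) (C := C)
    ((differentiable_petzOverlap hρ hσ').comp differentiable_neg) hneg
    (by simpa using petzOverlap_zero hρ hσ' hs hU htr)
    (fun z hz => hC (-z) (by simpa using hz))
    (fun t => by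
      have := norm_petzOverlap_I_mul_le (U := U) hρ hσ' hU htr (-t)
      simpa using this)
    (fun t => by
      have h1 : frobSq (petzCurve U ρ σ (-1 + Complex.I * (-t : ℝ))) ≤ Real.exp r := by
        rw [frobSq_petzCurve_neg_one_add hρ hσ hA hB hU hU']
        exact hr _
      have h2 : -(1 + Complex.I * t) = -1 + Complex.I * (-t : ℝ) := by
        push_cast
        ring
      rw [Function.comp_apply, h2]
      exact norm_petzOverlap_le_exp hρ hU htr h1)
  rw [mul_neg_one, Complex.neg_re, show (1 / 2 : ℂ) = ((1 / 2 : ℝ) : ℂ) by push_cast; rfl,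
    Complex.re_ofReal_mul, Complex.sub_re] at h
  rw [relEntropyDiff]
  linarith

/-- Truncation by `ENNReal.ofReal` is harmless: for `x ≤ 0` the bound is trivial, so the traces need
not be shown positive. -/
theorem le_exp_of_log_ofReal_lt {x r : ℝ} (h : ENNReal.log (ENNReal.ofReal x) < (r : EReal)) :
    x ≤ Real.exp r := by
  rcases le_or_gt x 0 with hx | hx
  · exact hx.trans (Real.exp_pos r).le
  · rw [ENNReal.log_ofReal_of_pos hx, EReal.coe_lt_coe_iff] at h
    exact ((Real.log_lt_iff_lt_exp hx).1 h).le

theorem iInf_zeroRelEntropy_le (hρ : ρ.PosSemidef) (htr : ρ.trace = 1) (hσ : σ.PosSemidef)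
    (hs : suppPow σ 0 * ρ = ρ) (hU : Uᴴ * U = 1) :
    (⨅ t : ℝ, zeroRelEntropy ρ (rotatedPetzMap σ (dilationMap U) t (dilationMap U ρ))) ≤
      (relEntropyDiff U ρ σ : ℝ) := by
  by_contra! h
  -- A real `r` strictly between the two sides turns the infimum into a bound uniform in `t`.
  obtain ⟨r, hr, hr'⟩ := EReal.lt_iff_exists_real_btwn.1 h
  refine absurd (le_relEntropyDiff hρ htr hσ hs hU fun t => ?_) (not_le.2 (EReal.coe_lt_coe_iff.1 hr))
  refine le_exp_of_log_ofReal_lt ?_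
  rw [EReal.coe_neg, ← EReal.lt_neg_comm]
  exact hr'.trans_le (iInf_le _ t)

theorem le_iSup_collisionRelEntropy (hρ : ρ.PosSemidef) (htr : ρ.trace = 1) (hσ : σ.PosDef)
    (hU : Uᴴ * U = 1) (hU' : U * Uᴴ = 1) (hA : (dilationMap U ρ).PosDef)
    (hB : (dilationMap U σ).PosDef) :
    (relEntropyDiff U ρ σ : ℝ) ≤ ⨆ t : ℝ,
      collisionRelEntropy ρ (rotatedPetzMap σ (dilationMap U) t (dilationMap U ρ)) := by
  by_contra! h
  obtain ⟨r, hr, hr'⟩ := EReal.lt_iff_exists_real_btwn.1 h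
  refine absurd (relEntropyDiff_le hρ htr hσ hU hU' hA hB fun t => ?_)
    (not_le.2 (EReal.coe_lt_coe_iff.1 hr'))
  refine le_exp_of_log_ofReal_lt ?_
  have ht := (le_iSup (fun t : ℝ =>
    collisionRelEntropy ρ (rotatedPetzMap σ (dilationMap U) t (dilationMap U ρ))) t).trans_lt hr
  beta_reduce at ht
  rw [collisionRelEntropy] at ht
  -- The value lies below a real number, so the `⊤` branch is impossible and the support condition
  -- needs no proof.
  split_ifs at ht
  · exact ht
  · exact absurd ht not_top_lt

end Recoverability

end QInfo

end

/-! ### The two recoverability inequalities. -/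

theorem theorem4
    {n m : Type*} [Fintype n] [DecidableEq n] [Fintype m] [DecidableEq m]
    {s e' b e : Type*} [Fintype s] [DecidableEq s] [Fintype e'] [DecidableEq e']
    [Fintype b] [DecidableEq b] [Fintype e] [DecidableEq e] :
    (∀ (ρ σ : Matrix n n ℂ) (N : Matrix n n ℂ →ₗ[ℂ] Matrix m m ℂ),
      QInfo.IsDensityOperator ρ → σ.PosSemidef → σ ≠ 0 → QInfo.IsQuantumChannel N →
      QInfo.supp ρ ≤ QInfo.supp σ →
      (⨅ t : ℝ, QInfo.zeroRelEntropy ρ (QInfo.rotatedPetzMap σ N t (N ρ))) ≤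
        QInfo.relEntropy ρ σ - QInfo.relEntropy (N ρ) (N σ)) ∧
    (∀ (ρ σ : Matrix (s × e') (s × e') ℂ) (U : Matrix (b × e) (s × e') ℂ)
      (N : Matrix (s × e') (s × e') ℂ →ₗ[ℂ] Matrix b b ℂ),
      ρ.PosDef → ρ.trace = 1 → σ.PosDef →
      U.conjTranspose * U = 1 → U * U.conjTranspose = 1 → N = QInfo.dilationMap U →
      (N ρ).PosDef → (N σ).PosDef →
      QInfo.relEntropy ρ σ - QInfo.relEntropy (N ρ) (N σ) ≤
        ⨆ t : ℝ, QInfo.collisionRelEntropy ρ (QInfo.rotatedPetzMap σ N t (N ρ))) := by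
  constructor
  · rintro ρ σ N ⟨hρ, htr⟩ hσ - hN hsupp
    have hs := (QInfo.supp_le_supp_iff hρ.1 hσ).1 hsupp
    -- Trace one excludes the zero space; the dilation needs a basis index to choose.
    have : Nonempty n := by
      by_contra hn
      rw [not_nonempty_iff] at hn
      simp [Matrix.trace] at htr
    obtain ⟨U, rfl, hU⟩ := hN.exists_dilation
    rw [QInfo.relEntropy_sub_relEntropy hρ hσ hs]
    exact QInfo.iInf_zeroRelEntropy_le hρ htr hσ hs hU
  · rintro ρ σ U N hρ htr hσ hU hU' rfl hA hB
    rw [QInfo.relEntropy_sub_relEntropy hρ.posSemidef hσ.posSemidef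
      (by rw [QInfo.suppPow_zero_eq_one hσ, Matrix.one_mul])]
    exact QInfo.le_iSup_collisionRelEntropy hρ.posSemidef htr hσ hU hU' hA hB
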